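/- Let $G$ be a countable discrete group acting on a compact Hausdorff space $X$ by homeomorphisms, and suppose the action is free (if $gx=x$ for some $x\in X$ then $g=1$). Let $C(X)\rtimes_r G$ be the reduced crossed product, with canonical copy of $C(X)$, canonical unitaries $u_g$ ($g\in G$) satisfying $u_g f u_g^*=f(g^{-1}\,\cdot\,)$ for $f\in C(X)$, and canonical conditional expectation $E: C(X)\rtimes_r G\to C(X)$ (the continuous linear map with $E(f u_g)=f$ if $g=1$ and $E(fu_g)=0$ if $g\neq 1$, for $f \in C(X)$). For $a\in C(X)\rtimes_r G$ and $g\in G$ put $a_g:=E(au_g^*)\in C(X)$; one writes formally $a=\sum_{g\in G}a_gu_g$, with no convergence implied. For $f\in C(X)$ let $\mathrm{supp}^\circ(f):=\{x\in X: f(x)\neq 0\}$ be its open support. Then for every $a\in C(X)\rtimes_r G$ the following are equivalent: 1. $a$ is an $r$-normalizer of $C(X)$ in $C(X)\rtimes_r G$, i.e. $a^*fa\in C(X)$ for every $f\in C(X)$; 2. the family $(\mathrm{supp}^\circ(a_g))_{g\in G}$ is pairwise disjoint, i.e. $\mathrm{supp}^\circ(a_g)\cap\mathrm{supp}^\circ(a_h)=\emptyset$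 for all $g\neq h$ in $G$. -/

import Mathlib

open scoped ENNReal

noncomputable section

/-! ### One-sided normalizers and open supports -/

/-- `a` is an `r`-normalizer of the `*`-subalgebra `D` of `A` if `a* D a ⊆ D`. -/
def IsRNormalizer {A : Type*} [Ring A] [StarRing A] [Algebra ℂ A] [StarModule ℂ A]
    (D : StarSubalgebra ℂ A) (a : A) : Prop :=
  ∀ d ∈ D, star a * d * a ∈ D

/-- The open support `f⁻¹(ℂ \ {0})` of a continuous function. -/
def openSupport {X : Type*} [TopologicalSpace X] (f : C(X, ℂ)) : Set X :=
  f ⁻¹' {0}ᶜ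

/-! ### The reduced crossed product of `C(X)` by a discrete group -/

namespace CrossedProduct

/-- The Hilbert space `ℓ²(G × X) = ⨁_{x ∈ X} ℓ²(G) = ℓ²(G, ℓ²(X))`. -/
abbrev HSpace (G X : Type*) : Type _ := lp (fun _ : G × X => ℂ) 2

section Defs

variable (G X : Type*) [Group G]

variable {G X} in
theorem memℓp_translate (h : G) (ξ : HSpace G X) :
    Memℓp (fun p : G × X => ξ (h⁻¹ * p.1, p.2)) 2 := by
  have hp : 0 < (2 : ℝ≥0∞).toReal := by norm_num
  have hξ := (memℓp_gen_iff hp).1 (lp.memℓp ξ)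
  rw [memℓp_gen_iff hp]
  exact (Equiv.summable_iff ((Equiv.mulLeft h⁻¹).prodCongr (Equiv.refl X))
    (f := fun p => ‖ξ p‖ ^ (2 : ℝ≥0∞).toReal)).2 hξ

/-- Left translation on `ℓ²(G × X)`: `(λ_h ξ)(g, x) = ξ(h⁻¹ g, x)`. -/
def translation (h : G) : HSpace G X →L[ℂ] HSpace G X :=
  LinearMap.mkContinuous
    { toFun := fun ξ => ⟨fun p => ξ (h⁻¹ * p.1, p.2), memℓp_translate h ξ⟩
      map_add' := fun _ _ => by ext p; rfl
      map_smul' := fun _ _ => by ext p; rfl }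
    1 (by
      intro ξ
      have hp : 0 < (2 : ℝ≥0∞).toReal := by norm_num
      rw [one_mul, lp.norm_eq_tsum_rpow hp, lp.norm_eq_tsum_rpow hp]
      exact (congrArg (· ^ (1 / (2 : ℝ≥0∞).toReal))
        (Equiv.tsum_eq ((Equiv.mulLeft h⁻¹).prodCongr (Equiv.refl X))
          (fun p => ‖ξ p‖ ^ (2 : ℝ≥0∞).toReal))).le)

variable {G X} in
@[simp] theorem translation_apply (h : G) (ξ : HSpace G X) (p : G × X) :
    translation G X h ξ p = ξ (h⁻¹ * p.1, p.2) := rfl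

theorem star_translation (h : G) :
    star (translation G X h) = translation G X h⁻¹ := by
  rw [ContinuousLinearMap.star_eq_adjoint]
  symm
  rw [ContinuousLinearMap.eq_adjoint_iff]
  intro ξ η
  rw [lp.inner_eq_tsum, lp.inner_eq_tsum]
  rw [← Equiv.tsum_eq ((Equiv.mulLeft h⁻¹).prodCongr (Equiv.refl X))]
  refine tsum_congr fun p => ?_
  simp [Prod.map]

theorem translation_one : translation G X 1 = 1 := by ext ξ p; simp

theorem translation_mul (g h : G) :
    translation G X (g * h) = translation G X g * translation G X h := by
  ext ξ p; simp [mul_assoc]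

variable [TopologicalSpace X] [CompactSpace X] [MulAction G X]

/-- The operator on `ℓ²(G × X)` given by `(π(f) ξ)(g, x) = f(g x) ξ(g, x)`. -/
def multiplication (f : C(X, ℂ)) : HSpace G X →L[ℂ] HSpace G X :=
  lp.mapCLM 2 (fun p : G × X => f (p.1 • p.2) • ContinuousLinearMap.id ℂ ℂ)
    (norm_nonneg f) (fun p => by
      rw [norm_smul]
      exact (mul_le_of_le_one_right (norm_nonneg _) ContinuousLinearMap.norm_id_le).trans
        (f.norm_coe_le_norm _))

variable {G X} in
@[simp] theorem multiplication_apply (f : C(X, ℂ)) (ξ : HSpace G X) (p : G × X) :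
    multiplication G X f ξ p = f (p.1 • p.2) * ξ p := rfl

theorem star_multiplication (f : C(X, ℂ)) :
    star (multiplication G X f) = multiplication G X (star f) := by
  rw [ContinuousLinearMap.star_eq_adjoint]
  symm
  rw [ContinuousLinearMap.eq_adjoint_iff]
  intro ξ η
  rw [lp.inner_eq_tsum, lp.inner_eq_tsum]
  refine tsum_congr fun p => ?_
  simp
  ring

/-- The canonical `*`-representation of `C(X)` on `ℓ²(G × X)`. -/
def rep : C(X, ℂ) →⋆ₐ[ℂ] (HSpace G X →L[ℂ] HSpace G X) where
  toFun := multiplication G X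
  map_one' := by ext ξ p; simp
  map_mul' f g := by ext ξ p; simp [mul_assoc]
  map_zero' := by ext ξ p; simp
  map_add' f g := by ext ξ p; simp [add_mul]
  commutes' c := by ext ξ p; simp [Algebra.algebraMap_eq_smul_one]
  map_star' f := (star_multiplication G X f).symm

/-- The covariance relation `λ_g π(f) = π(f ∘ g⁻¹) λ_g`. -/
theorem translation_mul_multiplication [ContinuousConstSMul G X] (g : G) (f : C(X, ℂ)) :
    translation G X g * multiplication G X f =
      multiplication G X (f.comp ⟨(g⁻¹ • ·), continuous_const_smul g⁻¹⟩) * translation G X g := by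
  ext ξ p; simp [mul_smul]

/-- The reduced crossed product `C(X) ⋊ G`: the C*-algebra of operators on `ℓ²(G × X)` generated
by the covariant pair `(π, λ)`. This is the regular representation picture associated with the
faithful representation of `C(X)` on `ℓ²(X)` by multiplication; equivalently, it is the reduced
C*-algebra of the transformation groupoid `G × X`. -/
def reducedCrossedProduct : StarSubalgebra ℂ (HSpace G X →L[ℂ] HSpace G X) :=
  (StarAlgebra.adjoin ℂ
    (Set.range (multiplication G X) ∪ Set.range (translation G X))).topologicalClosure

theorem multiplication_mem (f : C(X, ℂ)) : multiplication G X f ∈ reducedCrossedProduct G X :=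
  StarSubalgebra.le_topologicalClosure _
    (StarAlgebra.subset_adjoin ℂ _ (Or.inl ⟨f, rfl⟩))

theorem translation_mem (g : G) : translation G X g ∈ reducedCrossedProduct G X :=
  StarSubalgebra.le_topologicalClosure _
    (StarAlgebra.subset_adjoin ℂ _ (Or.inr ⟨g, rfl⟩))

/-- The canonical embedding `C(X) → C(X) ⋊ G`. -/
def incl : C(X, ℂ) →⋆ₐ[ℂ] reducedCrossedProduct G X :=
  (rep G X).codRestrict (reducedCrossedProduct G X) (multiplication_mem G X)

/-- The copy of `C(X)` in `C(X) ⋊ G`. -/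
def baseAlgebra : StarSubalgebra ℂ (reducedCrossedProduct G X) :=
  (incl G X).range

variable {G} in
/-- The canonical unitary `u_g` in `C(X) ⋊ G` implementing the action of `g`. -/
def u (g : G) : reducedCrossedProduct G X :=
  ⟨translation G X g, translation_mem G X g⟩

end Defs

/-! ### The canonical conditional expectation -/

section Expectation

variable {G X : Type*} [Group G]

open Classical in
/-- The diagonal matrix coefficient `⟨δ_(1,x), T δ_(1,x)⟩` of an operator `T` on `ℓ²(G × X)`. -/
def diagCoeff (T : HSpace G X →L[ℂ] HSpace G X) (x : X) : ℂ :=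
  T (lp.single 2 ((1, x) : G × X) (1 : ℂ)) (1, x)

theorem diagCoeff_add (S T : HSpace G X →L[ℂ] HSpace G X) (x : X) :
    diagCoeff (S + T) x = diagCoeff S x + diagCoeff T x := rfl

theorem diagCoeff_smul (c : ℂ) (T : HSpace G X →L[ℂ] HSpace G X) (x : X) :
    diagCoeff (c • T) x = c * diagCoeff T x := rfl

theorem norm_diagCoeff_le (T : HSpace G X →L[ℂ] HSpace G X) (x : X) :
    ‖diagCoeff T x‖ ≤ ‖T‖ := by
  classical
  refine (lp.norm_apply_le_norm (by norm_num) _ _).trans ((T.le_opNorm _).trans ?_)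
  rw [lp.norm_single (by norm_num)]
  simp

variable [TopologicalSpace X] [CompactSpace X] [MulAction G X]

open Classical in
theorem diagCoeff_mul (f : C(X, ℂ)) (g : G) (x : X) :
    diagCoeff (multiplication G X f * translation G X g) x = if g = 1 then f x else 0 := by
  simp [diagCoeff, Pi.single_apply]

theorem mem_span_of_mem_adjoin [ContinuousConstSMul G X] {T : HSpace G X →L[ℂ] HSpace G X}
    (hT : T ∈ StarAlgebra.adjoin ℂ
      (Set.range (multiplication G X) ∪ Set.range (translation G X))) :
    T ∈ Submodule.span ℂ {S | ∃ (f : C(X, ℂ)) (g : G),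
      S = multiplication G X f * translation G X g} := by
  let M : Submonoid (HSpace G X →L[ℂ] HSpace G X) :=
    { carrier := {S | ∃ (f : C(X, ℂ)) (g : G), S = multiplication G X f * translation G X g}
      one_mem' := ⟨1, 1, by
        rw [translation_one, mul_one]; exact (map_one (rep G X)).symm⟩
      mul_mem' := by
        rintro _ _ ⟨f, g, rfl⟩ ⟨f', g', rfl⟩
        refine ⟨f * f'.comp ⟨(g⁻¹ • ·), continuous_const_smul g⁻¹⟩, g * g', ?_⟩
        have h := map_mul (rep G X) f (f'.comp ⟨(g⁻¹ • ·), continuous_const_smul g⁻¹⟩)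
        change multiplication G X _ = multiplication G X _ * multiplication G X _ at h
        rw [h, translation_mul, mul_assoc, ← mul_assoc (translation G X g),
          translation_mul_multiplication]
        simp only [mul_assoc] }
  have hsub : (Set.range (multiplication G X) ∪ Set.range (translation G X)) ∪
      star (Set.range (multiplication G X) ∪ Set.range (translation G X)) ⊆ (M : Set _) := by
    have h1 : ∀ f, multiplication G X f ∈ M := fun f => ⟨f, 1, by rw [translation_one, mul_one]⟩
    have h2 : ∀ g, translation G X g ∈ M := fun g => ⟨1, g, by
      have h := map_one (rep G X)
      change multiplication G X 1 = 1 at h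
      rw [h, one_mul]⟩
    rintro S ((⟨f, rfl⟩ | ⟨g, rfl⟩) | (⟨f, hf⟩ | ⟨g, hg⟩))
    · exact h1 f
    · exact h2 g
    · rw [← star_star S, ← hf, star_multiplication]; exact h1 _
    · rw [← star_star S, ← hg, star_translation]; exact h2 _
  have hT' : T ∈ Subalgebra.toSubmodule (Algebra.adjoin ℂ
      ((Set.range (multiplication G X) ∪ Set.range (translation G X)) ∪
        star (Set.range (multiplication G X) ∪ Set.range (translation G X)))) := hT
  rw [Algebra.adjoin_eq_span] at hT'
  exact Submodule.span_mono (Submonoid.closure_le.2 hsub) hT'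

theorem continuous_diagCoeff [ContinuousConstSMul G X] {T : HSpace G X →L[ℂ] HSpace G X}
    (hT : T ∈ reducedCrossedProduct G X) : Continuous (diagCoeff T) := by
  classical
  refine continuous_of_uniform_approx_of_continuous fun V hV => ?_
  obtain ⟨ε, hε, hV⟩ := Metric.mem_uniformity_dist.1 hV
  obtain ⟨S, hS, hTS⟩ := Metric.mem_closure_iff.1 hT ε hε
  refine ⟨diagCoeff S, ?_, fun x => hV ?_⟩
  · refine Submodule.span_induction ?_ ?_ ?_ ?_ (mem_span_of_mem_adjoin hS)
    · rintro _ ⟨f, g, rfl⟩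
      simp only [funext (diagCoeff_mul f g)]
      split_ifs
      · exact f.continuous
      · exact continuous_const
    · exact continuous_const
    · intro S T _ _ hS hT
      exact hS.add hT
    · intro c S _ hS
      exact continuous_const.mul hS
  · refine lt_of_le_of_lt ?_ hTS
    rw [dist_eq_norm, dist_eq_norm]
    exact norm_diagCoeff_le (T - S) x

variable (G X) in
/-- The canonical conditional expectation `E : C(X) ⋊ G → C(X)`: the continuous linear map with
`E(f u_g) = f` if `g = 1` and `E(f u_g) = 0` otherwise. -/
def expectation [ContinuousConstSMul G X] : reducedCrossedProduct G X →L[ℂ] C(X, ℂ) :=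
  LinearMap.mkContinuous
    { toFun := fun a => ⟨diagCoeff a.1, continuous_diagCoeff a.2⟩
      map_add' := fun _ _ => rfl
      map_smul' := fun _ _ => rfl }
    1 (fun a => by
      rw [one_mul]
      exact (ContinuousMap.norm_le _ (norm_nonneg _)).2 (norm_diagCoeff_le a.1))

open Classical in
theorem expectation_incl_mul_u [ContinuousConstSMul G X] (f : C(X, ℂ)) (g : G) :
    expectation G X (incl G X f * u X g) = if g = 1 then f else 0 := by
  ext x
  refine (diagCoeff_mul f g x).trans ?_
  split_ifs <;> rfl

/-- The coefficient `a_g = E(a u_g*) ∈ C(X)` of `a ∈ C(X) ⋊ G`, so that formally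
`a = ∑ a_g u_g`. -/
def coeff [ContinuousConstSMul G X] (a : reducedCrossedProduct G X) (g : G) : C(X, ℂ) :=
  expectation G X (a * star (u X g))

end Expectation

end CrossedProduct

end

open scoped ComplexConjugate

namespace CrossedProduct

/-! ### Matrix coefficients on `ℓ²(G × X)`. -/

section MatrixCoefficients

variable {G X : Type*}

/-! As a matrix, `a` is block diagonal over `X`, and its entry at `(g, x), (h, x)` is `a_{gh⁻¹}(gx)`
(`matrixCoeff_eq_coeff`). It lies in `C(X)` exactly when its entries at `(1, x), (k, x)` with `k ≠
1` vanish (`mem_baseAlgebra_iff`). For `a* f a` this entry is `∑_g f(gx) conj(a_g(gx))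
a_{gk⁻¹}(gx)`. If the open supports are disjoint, every term is zero. Conversely, if the sum is zero
for all `f`, the atomic measure with these masses at the points `gx` annihilates `C(X)`. By freeness
these points are distinct, so each mass is zero (`eq_zero_of_forall_hasSum_zero`), which is
disjointness at `gx`. -/

open Classical in
/-- The matrix coefficient `⟨δ_p, T δ_q⟩` of an operator `T` on `ℓ²(G × X)`, as a continuous
linear functional of `T`. -/
noncomputable def matrixCoeff (p q : G × X) : (HSpace G X →L[ℂ] HSpace G X) →L[ℂ] ℂ :=
  (lp.evalCLM ℂ (fun _ : G × X => ℂ) 2 p).comp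
    (ContinuousLinearMap.apply ℂ (HSpace G X) (lp.single 2 q (1 : ℂ)))

open Classical in
theorem matrixCoeff_apply (p q : G × X) (T : HSpace G X →L[ℂ] HSpace G X) :
    matrixCoeff p q T = T (lp.single 2 q (1 : ℂ)) p := rfl

/-- An operator on `ℓ²(G × X)` is determined by its matrix coefficients. -/
theorem ext_matrixCoeff {S T : HSpace G X →L[ℂ] HSpace G X}
    (h : ∀ p q, matrixCoeff p q S = matrixCoeff p q T) : S = T := by
  classical
  refine lp.ext_continuousLinearMap (by norm_num) fun q => ?_
  ext p
  have := h p q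
  rw [matrixCoeff_apply, matrixCoeff_apply] at this
  simp only [ContinuousLinearMap.comp_apply, lp.singleContinuousLinearMap_apply]
  convert this

/-- The matrix coefficients of `S* T` are the inner products of the columns of `S` and `T`. -/
theorem hasSum_matrixCoeff_star_mul (S T : HSpace G X →L[ℂ] HSpace G X) (p q : G × X) :
    HasSum (fun r => conj (matrixCoeff r p S) * matrixCoeff r q T)
      (matrixCoeff p q (star S * T)) := by
  classical
  have h := lp.hasSum_inner (𝕜 := ℂ) (S (lp.single 2 p (1 : ℂ))) (T (lp.single 2 q (1 : ℂ)))
  rw [← ContinuousLinearMap.adjoint_inner_right, lp.inner_single_left] at h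
  rw [RCLike.inner_apply, map_one, mul_one] at h
  simp only [RCLike.inner_apply, mul_comm _ (conj _)] at h
  exact h

variable [Group G]

theorem matrixCoeff_mul_translation (T : HSpace G X →L[ℂ] HSpace G X) (k : G) (p q : G × X) :
    matrixCoeff p q (T * translation G X k) = matrixCoeff p (k * q.1, q.2) T := by
  classical
  rw [matrixCoeff_apply, matrixCoeff_apply, mul_apply_eq_comp]
  suffices h : translation G X k (lp.single 2 q (1 : ℂ)) = lp.single 2 (k * q.1, q.2) (1 : ℂ) by
    rw [h]
  refine Subtype.ext (funext fun r => ?_)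
  change translation G X k (lp.single 2 q (1 : ℂ)) r = _
  rw [translation_apply, lp.single_apply, lp.single_apply, Pi.single_apply, Pi.single_apply]
  simp only [Prod.ext_iff, inv_mul_eq_iff_eq_mul]

variable [TopologicalSpace X] [CompactSpace X] [MulAction G X]

theorem matrixCoeff_multiplication_mul (f : C(X, ℂ)) (T : HSpace G X →L[ℂ] HSpace G X)
    (p q : G × X) :
    matrixCoeff p q (multiplication G X f * T) = f (p.1 • p.2) * matrixCoeff p q T := rfl

open Classical in
theorem matrixCoeff_multiplication (f : C(X, ℂ)) (p q : G × X) :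
    matrixCoeff p q (multiplication G X f) = if p = q then f (p.1 • p.2) else 0 := by
  rw [← mul_one (multiplication G X f), matrixCoeff_multiplication_mul, matrixCoeff_apply,
    one_apply_eq_self, lp.single_apply, Pi.single_apply, mul_ite, mul_one, mul_zero]

/-- The matrix coefficients of `a* f a`. -/
theorem hasSum_matrixCoeff_conjugate (a : reducedCrossedProduct G X) (f : C(X, ℂ)) (x : X) (k : G) :
    HasSum (fun r : G × X => f (r.1 • r.2) *
        (conj (matrixCoeff r (1, x) a.1) * matrixCoeff r (k, x) a.1))
      (matrixCoeff (1, x) (k, x) (star a * incl G X f * a).1) := by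
  have h := hasSum_matrixCoeff_star_mul a.1 (multiplication G X f * a.1) (1, x) (k, x)
  simp only [matrixCoeff_multiplication_mul, mul_left_comm _ (f _)] at h
  rwa [← mul_assoc] at h

variable [ContinuousConstSMul G X]

/-- Linear and closed conditions on `C(X) ⋊ G` may be checked on the elements `f u_g`. -/
theorem eq_of_eq_on_generators {φ ψ : (HSpace G X →L[ℂ] HSpace G X) →L[ℂ] ℂ}
    (h : ∀ (f : C(X, ℂ)) (k : G), φ (multiplication G X f * translation G X k) =
      ψ (multiplication G X f * translation G X k))
    {T : HSpace G X →L[ℂ] HSpace G X} (hT : T ∈ reducedCrossedProduct G X) : φ T = ψ T := by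
  refine closure_minimal (t := {T | φ T = ψ T}) (fun S hS => ?_)
    (isClosed_eq φ.continuous ψ.continuous) hT
  refine Submodule.span_le (p := LinearMap.eqLocus φ.toLinearMap ψ.toLinearMap) |>.2 ?_
    (mem_span_of_mem_adjoin hS)
  rintro _ ⟨f, k, rfl⟩
  exact h f k

/-- Each `f u_k` preserves the fibres `G × {x}`, and this passes to closed linear spans. -/
theorem matrixCoeff_of_snd_ne {T : HSpace G X →L[ℂ] HSpace G X}
    (hT : T ∈ reducedCrossedProduct G X) {p q : G × X} (hpq : p.2 ≠ q.2) :
    matrixCoeff p q T = 0 := by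
  refine eq_of_eq_on_generators (φ := matrixCoeff p q) (ψ := 0) (fun f k => ?_) hT
  rw [matrixCoeff_mul_translation, matrixCoeff_multiplication, if_neg]
  · rfl
  · rintro rfl
    exact hpq rfl

theorem coeff_apply (a : reducedCrossedProduct G X) (k : G) (x : X) :
    coeff a k x = matrixCoeff (1, x) (k⁻¹, x) a.1 := by
  change matrixCoeff (1, x) (1, x) (a.1 * star (translation G X k)) = _
  rw [star_translation, matrixCoeff_mul_translation, mul_one]

/-- On `f u_k` both sides equal `f(gx)` if `kh = g` and `0` otherwise. -/
theorem matrixCoeff_eq_coeff (a : reducedCrossedProduct G X) (g h : G) (x : X) :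
    matrixCoeff (g, x) (h, x) a.1 = coeff a (g * h⁻¹) (g • x) := by
  classical
  rw [coeff_apply]
  refine eq_of_eq_on_generators (fun f k => ?_) a.2
  simp only [matrixCoeff_mul_translation, matrixCoeff_multiplication, one_smul]
  refine if_congr ?_ rfl rfl
  simp only [Prod.mk.injEq, and_true, mul_inv_rev, inv_inv, ← mul_assoc, eq_mul_inv_iff_mul_eq,
    one_mul]

/-- The row of `(1, x)` suffices: its entry at `(k, x)` is `a_{k⁻¹}(x)`, and as `x` varies these
determine the whole matrix. The function representing `a` is then `a_1 = E(a)`. -/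
theorem mem_baseAlgebra_iff (a : reducedCrossedProduct G X) :
    a ∈ baseAlgebra G X ↔ ∀ (x : X) (k : G), k ≠ 1 → matrixCoeff (1, x) (k, x) a.1 = 0 := by
  constructor
  · rintro ⟨f, rfl⟩ x k hk
    change matrixCoeff (1, x) (k, x) (multiplication G X f) = 0
    rw [matrixCoeff_multiplication, if_neg]
    exact fun h => hk (congrArg Prod.fst h).symm
  · intro h
    refine ⟨coeff a 1, Subtype.ext (ext_matrixCoeff ?_)⟩
    rintro ⟨g, x⟩ ⟨k, y⟩
    change matrixCoeff _ _ (multiplication G X (coeff a 1)) = _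
    rw [matrixCoeff_multiplication]
    by_cases hxy : x = y
    · subst hxy
      rw [matrixCoeff_eq_coeff]
      by_cases hgk : g = k
      · simp [hgk]
      · rw [if_neg (by simp [hgk]), coeff_apply, h]
        simpa [mul_inv_eq_one] using Ne.symm hgk
    · rw [matrixCoeff_of_snd_ne a.2 hxy, if_neg (by simp [hxy])]

end MatrixCoefficients

end CrossedProduct

/-! ### Separating the atoms of a summable measure. -/

/-- A summable family of point masses at distinct points of a compact Hausdorff space which
annihilates all continuous functions vanishes. -/
theorem eq_zero_of_forall_hasSum_zero {ι X : Type*} [TopologicalSpace X] [CompactSpace X]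
    [T2Space X] {y : ι → X} {c : ι → ℂ} (hc : Summable c)
    (hy : ∀ i j, c i ≠ 0 → c j ≠ 0 → y i = y j → i = j)
    (h : ∀ f : C(X, ℂ), HasSum (fun i => f (y i) * c i) 0) (i : ι) : c i = 0 := by
  classical
  by_contra hi
  obtain ⟨s, hs⟩ := summable_iff_vanishing_norm.1 hc.norm (‖c i‖ / 2) (half_pos (norm_pos_iff.2 hi))
  -- The mass outside the finite set `s` is small. Urysohn's lemma separates `y i` from the other
  -- atoms in `s`; indices of zero mass are left out because their points may coincide with `y i`.
  let F : Set X := y '' {j | j ∈ s ∧ j ≠ i ∧ c j ≠ 0}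
  have hF : IsClosed F :=
    ((s.finite_toSet.subset fun j hj => hj.1).image y).isClosed
  have hiF : Disjoint F {y i} := by
    rw [Set.disjoint_singleton_right]
    rintro ⟨j, ⟨-, hji, hj⟩, hyj⟩
    exact hji (hy j i hj hi hyj)
  obtain ⟨φ, hφ0, hφ1, hφ⟩ := exists_continuous_zero_one_of_isClosed hF isClosed_singleton hiF
  let f : C(X, ℂ) := ⟨fun x => (φ x : ℂ), by fun_prop⟩
  have hf1 : f (y i) = 1 := by
    change ((φ (y i) : ℝ) : ℂ) = 1
    rw [hφ1 rfl]; simp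
  have hfs : ∀ j ∈ s, j ≠ i → f (y j) * c j = 0 := by
    intro j hj hji
    by_cases hcj : c j = 0
    · rw [hcj, mul_zero]
    · have : φ (y j) = 0 := hφ0 ⟨j, ⟨hj, hji, hcj⟩, rfl⟩
      change ((φ (y j) : ℝ) : ℂ) * c j = 0
      rw [this, Complex.ofReal_zero, zero_mul]
  have hle : ∀ j, ‖f (y j) * c j‖ ≤ ‖c j‖ := by
    intro j
    rw [norm_mul]
    refine mul_le_of_le_one_left (norm_nonneg _) ?_
    change ‖((φ (y j) : ℝ) : ℂ)‖ ≤ 1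
    rw [Complex.norm_real, Real.norm_of_nonneg (hφ _).1]
    exact (hφ _).2
  -- The terms other than `i` sum to `-c i`, yet only those outside `s` survive, with total norm at
  -- most `‖c i‖ / 2`.
  have hsum := hasSum_ite_sub_hasSum (h f) i
  rw [hf1, one_mul, zero_sub] at hsum
  have hlim : ‖-c i‖ ≤ ‖c i‖ / 2 := by
    refine le_of_tendsto hsum.norm (Filter.Eventually.of_forall fun t => ?_)
    rw [← Finset.sum_subset (Finset.sdiff_subset (s := t) (t := s)) fun j hjt hj => ?_]
    · refine (norm_sum_le_of_le (f := fun j => if j = i then 0 else f (y j) * c j)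
        (n := fun j => ‖c j‖) _ fun j _ => ?_).trans
        ((le_abs_self _).trans (hs (t \ s) Finset.sdiff_disjoint).le)
      split_ifs
      · simp
      · exact hle j
    · split_ifs with hji
      · rfl
      · exact hfs j (by simpa [hjt] using hj) hji
  rw [norm_neg] at hlim
  linarith [norm_pos_iff.2 hi]

/-! ### The equivalence. -/

theorem mainTheorem5 {G X : Type*} [Group G] [Countable G]
    [TopologicalSpace X] [CompactSpace X] [T2Space X]
    [MulAction G X] [ContinuousConstSMul G X]
    (hfree : ∀ (g : G) (x : X), g • x = x → g = 1)
    (a : CrossedProduct.reducedCrossedProduct G X) :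
    IsRNormalizer (CrossedProduct.baseAlgebra G X) a ↔
      Pairwise fun g h : G =>
        Disjoint (openSupport (CrossedProduct.coeff a g))
          (openSupport (CrossedProduct.coeff a h)) := by
  have hbase : IsRNormalizer (CrossedProduct.baseAlgebra G X) a ↔ ∀ (f : C(X, ℂ)) (x : X) (k : G),
      k ≠ 1 → CrossedProduct.matrixCoeff (1, x) (k, x)
        (star a * CrossedProduct.incl G X f * a).1 = 0 := by
    simp only [← CrossedProduct.mem_baseAlgebra_iff]
    exact ⟨fun h f => h _ ⟨f, rfl⟩, fun h d ⟨f, hf⟩ => hf ▸ h f⟩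
  rw [hbase]
  constructor
  · intro h g k hgk
    rw [Set.disjoint_left]
    intro y hg hk
    have hne : k⁻¹ * g ≠ 1 := fun e => hgk (inv_mul_eq_one.1 e).symm
    -- With this `x` and column `(k⁻¹ * g, x)`, the atom indexed by `(g, x)` sits at `y` with mass
    -- `conj(a_g(y)) a_k(y)`.
    set x : X := g⁻¹ • y with hx
    have hzero := eq_zero_of_forall_hasSum_zero (y := fun r : G × X => r.1 • r.2)
      (c := fun r : G × X => conj (CrossedProduct.matrixCoeff r (1, x) a.1) *
        CrossedProduct.matrixCoeff r (k⁻¹ * g, x) a.1)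
      -- Summability of the masses is the case `f = 1`.
      (by simpa using (CrossedProduct.hasSum_matrixCoeff_conjugate a 1 x (k⁻¹ * g)).summable)
      (by
        -- Nonzero mass forces the index into the fibre over `x`, where freeness makes `g ↦ gx`
        -- injective.
        have hsnd : ∀ r : G × X, conj (CrossedProduct.matrixCoeff r (1, x) a.1) *
            CrossedProduct.matrixCoeff r (k⁻¹ * g, x) a.1 ≠ 0 → r.2 = x := by
          intro r hr
          by_contra hrx
          exact hr (by rw [CrossedProduct.matrixCoeff_of_snd_ne a.2 hrx, map_zero, zero_mul])
        rintro ⟨g₁, x₁⟩ ⟨g₂, x₂⟩ h₁ h₂ h₁₂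
        have e₁ : x₁ = x := hsnd _ h₁
        have e₂ : x₂ = x := hsnd _ h₂
        rw [e₁, e₂] at h₁₂
        have := hfree (g₂⁻¹ * g₁) x (by rw [mul_smul, inv_smul_eq_iff]; exact h₁₂)
        rw [e₁, e₂, inv_mul_eq_one.1 this])
      (fun f => h f x _ hne ▸ CrossedProduct.hasSum_matrixCoeff_conjugate a f x (k⁻¹ * g)) (g, x)
    simp only [CrossedProduct.matrixCoeff_eq_coeff, hx, smul_inv_smul, mul_eq_zero, inv_one,
      mul_one, mul_inv_rev, inv_inv, mul_inv_cancel_left, map_eq_zero] at hzero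
    exact hzero.elim hg hk
  · intro h f x k hk
    refine (CrossedProduct.hasSum_matrixCoeff_conjugate a f x k).unique ?_
    convert hasSum_zero using 2 with r
    obtain ⟨g, y⟩ := r
    by_cases hy : y = x
    · subst hy
      rw [CrossedProduct.matrixCoeff_eq_coeff, CrossedProduct.matrixCoeff_eq_coeff]
      by_contra hne
      -- The two factors are values at `gx` of the coefficients at `g` and `gk⁻¹`, distinct as `k ≠
      -- 1`.
      have hgk : g * 1⁻¹ ≠ g * k⁻¹ := by simpa using hk
      have hd := Set.disjoint_left.1 (h hgk)
      refine @hd (g • y) ?_ ?_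
      · intro h0
        exact hne (by rw [Set.mem_singleton_iff.1 h0, map_zero, zero_mul, mul_zero])
      · intro h0
        exact hne (by rw [Set.mem_singleton_iff.1 h0, mul_zero, mul_zero])
    · rw [CrossedProduct.matrixCoeff_of_snd_ne a.2 (q := (1, x)) hy, map_zero, zero_mul, mul_zero]
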